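/- Let $V$ be a finite set. A clutter over $V$ is a family $\mathcal{C}$ of subsets of $V$ (its members), none of which contains another one; its filter oracle answers, for any queried set $X\subseteq V$, whether or not $X$ contains a member of $\mathcal{C}$. For disjoint $I,J\subseteq V$, the minor $\mathcal{C}\setminus I/J$ is the clutter over $V-(I\cup J)$ whose members are the inclusionwise minimal sets in $\{C-J : C\in\mathcal{C},\ C\cap I=\emptyset\}$. A $\Delta_3$ minor of $\mathcal{C}$ is a minor that becomes $\{\{1,2\},\{2,3\},\{3,1\}\}$ (over the ground set $\{1,2,3\}$) after relabeling its ground set. **Theorem.** Let $n\ge 2$ be an integer and $|V|=2n$. Let $\mathfrak{D}_{2n}$ be a deterministic (adaptive) algorithm that, given any clutter $\mathcal{C}$ over $V$ via a filter oracle, decides whether or not $\mathcal{C}$ has a $\Delta_3$ minor. Then in the worst case $\mathfrak{D}_{2n}$ must make at least $2^n$ calls to the filter oracle; that is, there is a clutter $\mathcal{C}$ over $V$ on which $\mathfrak{D}_{2n}$ makes at least $2^n$ calls. -/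

import Mathlib

/-- A clutter with ground set `V`: a family of subsets of `V`, called members, none of which
contains another one.  (The empty family and `{∅}` are clutters.) -/
structure Clutter (V : Type*) where
  /-- the members of the clutter -/
  members : Set (Finset V)
  /-- no member contains another one -/
  antichain : IsAntichain (· ⊆ ·) members

namespace Clutter

/-- The answer of the filter oracle of `C` to the query `X`: does `X` contain a member of `C`? -/
noncomputable def filterOracle {V : Type*} (C : Clutter V) (X : Finset V) : Bool :=
  open Classical in decide (∃ A ∈ C.members, A ⊆ X)

/-- The family `{A - J : A ∈ C, A ∩ I = ∅}`, as a family of subsets of `V - (I ∪ J)`. -/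
noncomputable def preMinor {V : Type*} (C : Clutter V) (I J : Finset V) :
    Set (Finset {x : V // x ∉ I ∧ x ∉ J}) :=
  open Classical in
  {B | ∃ A ∈ C.members, Disjoint A I ∧ B = A.subtype (fun x => x ∉ I ∧ x ∉ J)}

/-- The minor of `C` obtained after deleting `I` and contracting `J` (for disjoint `I`, `J`): the
clutter over `V - (I ∪ J)` whose members are the inclusionwise minimal sets in
`{A - J : A ∈ C, A ∩ I = ∅}`. -/
noncomputable def minor {V : Type*} (C : Clutter V) (I J : Finset V) :
    Clutter {x : V // x ∉ I ∧ x ∉ J} where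
  members := {B | Minimal (· ∈ C.preMinor I J) B}
  antichain := setOfPred_minimal_antichain _

/-- Two clutters are isomorphic if one is obtained from the other by relabeling its ground set. -/
def Isomorphic {V W : Type*} (C : Clutter V) (D : Clutter W) : Prop :=
  ∃ e : V ≃ W, D.members = (fun A : Finset V => A.map e.toEmbedding) '' C.members

/-- The clutter `{{0,1},{1,2},{2,0}}` over a ground set of three elements. -/
def delta3 : Clutter (Fin 3) where
  members := {{0, 1}, {1, 2}, {2, 0}}
  antichain := by
    rintro A (rfl | rfl | rfl) B (rfl | rfl | rfl) hAB <;> first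
      | exact absurd rfl hAB
      | (rw [Pi.compl_apply, Pi.compl_apply, compl_iff_not]; decide)

/-- `C` has a minor isomorphic to `{{0,1},{1,2},{2,0}}`. -/
def HasDelta3Minor {V : Type*} (C : Clutter V) : Prop :=
  ∃ I J : Finset V, Disjoint I J ∧ (C.minor I J).Isomorphic delta3

end Clutter

/-- A deterministic algorithm that accesses its input, a clutter over `V`, only through oracle
calls on subsets of `V`: at every moment it either stops with a yes/no output or calls the oracle on
a set `X` and continues in a way that may depend arbitrarily on all answers received so far. -/
inductive FilterAlgorithm (V : Type*) where
  | output (b : Bool) : FilterAlgorithm V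
  | query (X : Finset V) (next : Bool → FilterAlgorithm V) : FilterAlgorithm V

namespace FilterAlgorithm

/-- The output of the algorithm when it is run with the oracle `f`. -/
def result {V : Type*} (f : Finset V → Bool) : FilterAlgorithm V → Bool
  | output b => b
  | query X next => result f (next (f X))

/-- The number of oracle calls that the algorithm makes when it is run with the oracle `f`. -/
def calls {V : Type*} (f : Finset V → Bool) : FilterAlgorithm V → ℕ
  | output _ => 0
  | query X next => calls f (next (f X)) + 1

/-- On every clutter over `V`, given via its filter oracle, the algorithm decides correctly whether
or not the clutter has a `Δ₃` minor. -/
def DecidesDelta3Minor {V : Type*} (D : FilterAlgorithm V) : Prop :=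
  ∀ C : Clutter V, D.result C.filterOracle = true ↔ C.HasDelta3Minor

end FilterAlgorithm

/-!
The ground set is split into `n` pairs by a fixed-point-free involution `σ`.  A *transversal* picks
exactly one element of every pair, so the `2 ^ n` transversals are the vertices of an
`n`-dimensional cube, two of them being adjacent if they differ by `{a, σ a}` for some `a`.  For
every set `O` of transversals, the sets that meet all pairs and do not lie in `O` form an up-set,
because a proper superset of a transversal is not a transversal; it is the filter of a clutter
`offClutter σ O`.  So the oracle answers about the transversals can be prescribed freely, while all
other answers are fixed.

The clutter `offClutter σ O` has a `Δ₃` minor if and only if `O` contains two adjacent vertices of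
the cube (`offClutter_hasDelta3Minor_iff`).  Therefore the algorithm must decide whether `O` is
independent, and this needs a query at every vertex, by a parity argument.

* If fewer queries are made on every input, then each leaf of the decision tree leaves some vertex
  undetermined, is reached by an even number of sets `O`, and so every output is given on an even
  number of sets `O` (`FilterAlgorithm.even_sum_powerset`).
* The number of independent sets is odd: flipping all vertices along one fixed pair is an
  involution on independent sets, and it fixes only `∅`, since a vertex and its flip are adjacent
  (`odd_card_independent`).
-/

open scoped symmDiff

namespace Clutter

/-! ### Clutters and their filters -/

lemma filterOracle_eq_true {V : Type*} (C : Clutter V) (X : Finset V) :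
    C.filterOracle X = true ↔ ∃ A ∈ C.members, A ⊆ X := by
  simp [filterOracle]

lemma filterOracle_mono {V : Type*} (C : Clutter V) {X Y : Finset V} (h : X ⊆ Y)
    (hX : C.filterOracle X = true) : C.filterOracle Y = true := by
  rw [filterOracle_eq_true] at *
  obtain ⟨A, hA, hAX⟩ := hX
  exact ⟨A, hA, hAX.trans h⟩

lemma mem_members_iff_minimal {V : Type*} (C : Clutter V) (A : Finset V) :
    A ∈ C.members ↔ Minimal (fun X => C.filterOracle X = true) A := by
  simp only [filterOracle_eq_true]
  constructor
  · intro hA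
    refine ⟨⟨A, hA, subset_rfl⟩, ?_⟩
    rintro X ⟨B, hB, hBX⟩ hXA
    have : B = A := C.antichain.eq hB hA (hBX.trans hXA)
    exact this ▸ hBX
  · rintro ⟨⟨B, hB, hBA⟩, hmin⟩
    have : A ⊆ B := hmin ⟨B, hB, subset_rfl⟩ hBA
    rwa [this.antisymm hBA]

/-- The filter of a minor is the restriction of the filter to the interval from `J` to the
complement of `I`. -/
lemma filterOracle_minor {V : Type*} [DecidableEq V] (C : Clutter V) {I J : Finset V}
    (hIJ : Disjoint I J) (B : Finset {x : V // x ∉ I ∧ x ∉ J}) :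
    (C.minor I J).filterOracle B = true ↔
      C.filterOracle (B.map (Function.Embedding.subtype _) ∪ J) = true := by
  classical
  simp only [filterOracle_eq_true]
  constructor
  · rintro ⟨M, hM, hMB⟩
    obtain ⟨A, hA, hAI, rfl⟩ := hM.prop
    refine ⟨A, hA, fun x hx => ?_⟩
    by_cases hxJ : x ∈ J
    · exact Finset.mem_union_right _ hxJ
    · have hxI : x ∉ I := Finset.disjoint_left.1 hAI hx
      refine Finset.mem_union_left _ (Finset.mem_map.2 ⟨⟨x, hxI, hxJ⟩, hMB ?_, rfl⟩)
      simpa using hx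
  · rintro ⟨A, hA, hAB⟩
    have hAI : Disjoint A I := by
      refine Finset.disjoint_left.2 fun x hx hxI => ?_
      rcases Finset.mem_union.1 (hAB hx) with h | h
      · obtain ⟨y, -, rfl⟩ := Finset.mem_map.1 h
        exact y.2.1 hxI
      · exact Finset.disjoint_left.1 hIJ hxI h
    have hmem : A.subtype (fun x => x ∉ I ∧ x ∉ J) ∈ C.preMinor I J :=
      ⟨A, hA, hAI, by ext; simp⟩
    obtain ⟨M, hM, hmin⟩ := exists_minimal_le_of_wellFoundedLT
      (· ∈ C.preMinor I J) _ hmem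
    refine ⟨M, hmin, hM.trans fun x hx => ?_⟩
    rcases Finset.mem_union.1 (hAB (Finset.mem_subtype.1 hx)) with h | h
    · obtain ⟨y, hy, hyx⟩ := Finset.mem_map.1 h
      rwa [← Subtype.ext hyx]
    · exact absurd h x.2.2

/-- The clutter of the minimal sets of `F`.  If `F` is an up-set, then `F` is its filter. -/
def ofFilter {V : Type*} (F : Set (Finset V)) : Clutter V where
  members := {X | Minimal (· ∈ F) X}
  antichain := setOfPred_minimal_antichain _

lemma filterOracle_ofFilter {V : Type*} {F : Set (Finset V)} (hF : IsUpperSet F) (X : Finset V) :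
    (ofFilter F).filterOracle X = true ↔ X ∈ F := by
  rw [filterOracle_eq_true]
  constructor
  · rintro ⟨A, hA, hAX⟩
    exact hF hAX hA.prop
  · intro hX
    obtain ⟨M, hM, hmin⟩ := exists_minimal_le_of_wellFoundedLT (· ∈ F) X hX
    exact ⟨M, hmin, hM⟩

/-! ### `Δ₃` minors in terms of the filter -/

lemma filterOracle_delta3 (Z : Finset (Fin 3)) :
    delta3.filterOracle Z = true ↔ 2 ≤ Z.card := by
  have h : (({0, 1} ⊆ Z ∨ {1, 2} ⊆ Z ∨ {2, 0} ⊆ Z) ↔ 2 ≤ Z.card) := by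
    revert Z; decide
  rw [← h, filterOracle_eq_true]
  simp [delta3]

/-- A `Δ₃` minor amounts to three elements outside a set `J` of contracted elements such that a
subset `Z` of the three, together with `J`, belongs to the filter exactly if `Z` has at least two
elements; all remaining elements are deleted. -/
lemma hasDelta3Minor_iff_embedding {V : Type*} [Fintype V] [DecidableEq V] (C : Clutter V) :
    C.HasDelta3Minor ↔ ∃ (g : Fin 3 ↪ V) (J : Finset V), (∀ i, g i ∉ J) ∧
      ∀ Z : Finset (Fin 3), C.filterOracle (Z.map g ∪ J) = true ↔ 2 ≤ Z.card := by
  constructor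
  · rintro ⟨I, J, hIJ, e, he⟩
    refine ⟨e.symm.toEmbedding.trans (Function.Embedding.subtype _), J,
      fun i => (e.symm i).2.2, fun Z => ?_⟩
    rw [← Finset.map_map, ← filterOracle_minor C hIJ, ← filterOracle_delta3, filterOracle_eq_true,
      filterOracle_eq_true, he]
    simp only [Set.mem_image, exists_exists_and_eq_and]
    simp only [Finset.subset_map_symm]
  · rintro ⟨g, J, hgJ, hZ⟩
    have hIJ : Disjoint ((Finset.univ.map g ∪ J)ᶜ) J :=
      disjoint_compl_left.mono_right Finset.subset_union_right
    have hg : ∀ i, g i ∉ (Finset.univ.map g ∪ J)ᶜ ∧ g i ∉ J := fun i => ⟨by simp, hgJ i⟩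
    let e' : Fin 3 ≃ {x : V // x ∉ (Finset.univ.map g ∪ J)ᶜ ∧ x ∉ J} :=
      Equiv.ofBijective (fun i => ⟨g i, hg i⟩) ⟨fun i j h => g.injective (congrArg Subtype.val h),
        fun ⟨x, hx, hxJ⟩ => by
          have : ∃ i, g i = x := by simpa [hxJ] using hx
          obtain ⟨i, rfl⟩ := this
          exact ⟨i, rfl⟩⟩
    refine ⟨_, J, hIJ, e'.symm, ?_⟩
    have key : ∀ Z : Finset (Fin 3),
        (C.minor ((Finset.univ.map g ∪ J)ᶜ) J).filterOracle (Z.map e'.toEmbedding) = true ↔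
          delta3.filterOracle Z = true := by
      intro Z
      rw [filterOracle_minor C hIJ, filterOracle_delta3, ← hZ, Finset.map_map]
      exact Iff.rfl
    ext Z
    have hmin : Z ∈ delta3.members ↔
        Z.map e'.toEmbedding ∈ (C.minor ((Finset.univ.map g ∪ J)ᶜ) J).members := by
      rw [mem_members_iff_minimal, mem_members_iff_minimal]
      constructor
      · rintro ⟨h1, h2⟩
        refine ⟨(key Z).2 h1, fun Y hY hYZ => ?_⟩
        obtain ⟨W, rfl⟩ : ∃ W, W.map e'.toEmbedding = Y :=
          ⟨Y.map e'.symm.toEmbedding, by ext; simp⟩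
        exact Finset.map_subset_map.2 (h2 ((key W).1 hY) (Finset.map_subset_map.1 hYZ))
      · rintro ⟨h1, h2⟩
        refine ⟨(key Z).1 h1, fun W hW hWZ => ?_⟩
        exact Finset.map_subset_map.1 (h2 ((key W).2 hW) (Finset.map_subset_map.2 hWZ))
    rw [hmin]
    constructor
    · intro h
      exact ⟨_, h, by ext; simp⟩
    · rintro ⟨A, hA, rfl⟩
      convert hA
      ext; simp

/-- The elementwise form of `hasDelta3Minor_iff_embedding`. -/
lemma hasDelta3Minor_iff {V : Type*} [Fintype V] [DecidableEq V] (C : Clutter V) :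
    C.HasDelta3Minor ↔ ∃ (J : Finset V) (a b c : V),
      (a ∉ J ∧ b ∉ J ∧ c ∉ J) ∧ (a ≠ b ∧ a ≠ c ∧ b ≠ c) ∧
      (C.filterOracle (insert a (insert b J)) = true ∧
        C.filterOracle (insert a (insert c J)) = true ∧
        C.filterOracle (insert b (insert c J)) = true) ∧
      (¬ C.filterOracle (insert a J) = true ∧ ¬ C.filterOracle (insert b J) = true ∧
        ¬ C.filterOracle (insert c J) = true) := by
  rw [hasDelta3Minor_iff_embedding]
  constructor
  · rintro ⟨g, J, hgJ, hZ⟩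
    refine ⟨J, g 0, g 1, g 2, ⟨hgJ 0, hgJ 1, hgJ 2⟩, by simp, ⟨?_, ?_, ?_⟩, ?_, ?_, ?_⟩
    · simpa using hZ {0, 1}
    · simpa using hZ {0, 2}
    · simpa using hZ {1, 2}
    · simpa using hZ {0}
    · simpa using hZ {1}
    · simpa using hZ {2}
  · rintro ⟨J, a, b, c, ⟨ha, hb, hc⟩, ⟨hab, hac, hbc⟩, ⟨h1, h2, h3⟩, h4, h5, h6⟩
    have hinj : Function.Injective ![a, b, c] := by
      intro i j h
      fin_cases i <;> fin_cases j <;> simp_all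
    refine ⟨⟨![a, b, c], hinj⟩, J, fun i => by fin_cases i <;> simpa, fun Z => ?_⟩
    have hle : ∀ {W W' : Finset (Fin 3)}, W ⊆ W' →
        W.map ⟨![a, b, c], hinj⟩ ∪ J ⊆ W'.map ⟨![a, b, c], hinj⟩ ∪ J := fun h =>
      Finset.union_subset_union_left (Finset.map_subset_map.2 h)
    constructor
    · intro h
      by_contra hZ
      have : Z ⊆ {0} ∨ Z ⊆ {1} ∨ Z ⊆ {2} := by clear h; revert Z; decide
      rcases this with hs | hs | hs
      · exact h4 (by simpa using C.filterOracle_mono (hle hs) h)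
      · exact h5 (by simpa using C.filterOracle_mono (hle hs) h)
      · exact h6 (by simpa using C.filterOracle_mono (hle hs) h)
    · intro hZ
      have : {0, 1} ⊆ Z ∨ {0, 2} ⊆ Z ∨ {1, 2} ⊆ Z := by revert Z; decide
      rcases this with hs | hs | hs
      · exact C.filterOracle_mono (hle hs) (by simpa using h1)
      · exact C.filterOracle_mono (hle hs) (by simpa using h2)
      · exact C.filterOracle_mono (hle hs) (by simpa using h3)

end Clutter

/-! ### Transversals of a pairing -/

/-- `X` meets every pair `{v, σ v}`. -/
def MeetsPairs {V : Type*} (σ : V → V) (X : Finset V) : Prop :=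
  ∀ v, v ∈ X ∨ σ v ∈ X

/-- `X` contains exactly one element of every pair `{v, σ v}`. -/
def IsTransversal {V : Type*} (σ : V → V) (X : Finset V) : Prop :=
  ∀ v, v ∈ X ↔ σ v ∉ X

/-- The family `O`, viewed as a set of vertices of the cube of transversals, contains two adjacent
vertices.  Adjacency is written as a symmetric difference with a pair, so that flips along
different pairs commute. -/
def HasEdge {V : Type*} [DecidableEq V] (σ : V → V) (O : Finset (Finset V)) : Prop :=
  ∃ X ∈ O, ∃ a, X ∆ {a, σ a} ∈ O

section Transversal

variable {V : Type*} {σ : V → V}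

lemma IsTransversal.meetsPairs {X : Finset V} (hX : IsTransversal σ X) : MeetsPairs σ X := by
  intro v
  have := hX v
  tauto

lemma IsTransversal.eq_of_subset {X Y : Finset V} (hY : IsTransversal σ Y) (hX : MeetsPairs σ X)
    (h : X ⊆ Y) : X = Y := by
  refine h.antisymm fun v hv => ?_
  rcases hX v with h1 | h1
  · exact h1
  · exact absurd (h h1) ((hY v).1 hv)

lemma IsTransversal.symmDiff_pair [DecidableEq V] (hσ : Function.Involutive σ) {X : Finset V}
    (hX : IsTransversal σ X) (a : V) : IsTransversal σ (X ∆ {a, σ a}) := by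
  intro v
  have h1 := hX v
  have h2 : σ v = a ↔ v = σ a := hσ.eq_iff
  have h3 : σ v = σ a ↔ v = a := hσ.injective.eq_iff
  simp only [Finset.mem_symmDiff, Finset.mem_insert, Finset.mem_singleton, h2, h3]
  tauto

/-- The clutter whose filter consists of the sets that meet all pairs and are not in `O`. -/
def offClutter (σ : V → V) (O : Finset (Finset V)) : Clutter V :=
  Clutter.ofFilter {X | MeetsPairs σ X ∧ X ∉ O}

lemma filterOracle_offClutter {O : Finset (Finset V)} (hO : ∀ X ∈ O, IsTransversal σ X)
    (X : Finset V) :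
    (offClutter σ O).filterOracle X = true ↔ MeetsPairs σ X ∧ X ∉ O := by
  refine Clutter.filterOracle_ofFilter ?_ X
  rintro X Y hXY ⟨h1, h2⟩
  refine ⟨fun v => (h1 v).imp (@hXY v) (@hXY (σ v)), fun hY => h2 ?_⟩
  rwa [(hO Y hY).eq_of_subset h1 hXY]

/-- If `J` meets all pairs but `{a, σ a}`, then `J ∪ {a}` and `J ∪ {σ a}` meet all pairs, so they can
only be outside the filter by being in `O`; there they are adjacent. -/
lemma hasEdge_of_insert [DecidableEq V] (hσ : Function.Involutive σ)
    {O : Finset (Finset V)} {J : Finset V} {a : V}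
    (ha : a ∉ J) (hb : σ a ∉ J) (hne : σ a ≠ a)
    (h1 : MeetsPairs σ (insert a (insert (σ a) J)))
    (h4 : ¬ (MeetsPairs σ (insert a J) ∧ insert a J ∉ O))
    (h5 : ¬ (MeetsPairs σ (insert (σ a) J) ∧ insert (σ a) J ∉ O)) : HasEdge σ O := by
  have hmeet : ∀ v, v = a ∨ v = σ a ∨ v ∈ J ∨ σ v ∈ J := by
    intro v
    have h2 : σ v = a ↔ v = σ a := hσ.eq_iff
    have h3 : σ v = σ a ↔ v = a := hσ.injective.eq_iff
    have := h1 v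
    simp only [Finset.mem_insert, h2, h3] at this
    tauto
  have hA : insert a J ∈ O := by
    by_contra h
    refine h4 ⟨fun v => ?_, h⟩
    have h2 : σ v = a ↔ v = σ a := hσ.eq_iff
    have := hmeet v
    simp only [Finset.mem_insert, h2]
    tauto
  have hB : insert (σ a) J ∈ O := by
    by_contra h
    refine h5 ⟨fun v => ?_, h⟩
    have h3 : σ v = σ a ↔ v = a := hσ.injective.eq_iff
    have := hmeet v
    simp only [Finset.mem_insert, h3]
    tauto
  refine ⟨_, hA, a, ?_⟩
  convert hB using 1
  ext v
  simp only [Finset.mem_symmDiff, Finset.mem_insert, Finset.mem_singleton]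
  by_cases hva : v = a
  · subst hva; simp [ha, hne.symm]
  · by_cases hvb : v = σ a
    · subst hvb; simp [hb, hne]
    · simp [hva, hvb]

/-- If `J`, `a`, `b`, `c` show a `Δ₃` minor, then `J` misses exactly one pair, two of `a`, `b`, `c`
form this pair, and adding either of them to `J` gives a vertex in `O`.  Conversely, if `X` and its
flip along `{a, σ a}` are in `O`, then `J = X - a`, `a`, `σ a` and any further `c ∉ X` show a `Δ₃`
minor; such a `c` exists as there is a second pair. -/
lemma offClutter_hasDelta3Minor_iff [Fintype V] [DecidableEq V] (hσ : Function.Involutive σ)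
    (hfix : ∀ v, σ v ≠ v) (hcard : 2 < Fintype.card V)
    {O : Finset (Finset V)} (hO : ∀ X ∈ O, IsTransversal σ X) :
    (offClutter σ O).HasDelta3Minor ↔ HasEdge σ O := by
  simp only [Clutter.hasDelta3Minor_iff, filterOracle_offClutter hO]
  constructor
  · rintro ⟨J, a, b, c, ⟨ha, hb, hc⟩, ⟨hab, hac, hbc⟩, ⟨⟨h1, -⟩, ⟨h2, -⟩, ⟨h3, -⟩⟩, h4, h5, h6⟩
    have hJ : ¬ MeetsPairs σ J := by
      intro hJ
      refine h4 ⟨fun v => (hJ v).imp (Finset.mem_insert_of_mem) (Finset.mem_insert_of_mem),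
        fun hmem => ha ?_⟩
      rw [(hO _ hmem).eq_of_subset hJ (Finset.subset_insert _ _)]
      exact Finset.mem_insert_self _ _
    obtain ⟨p, hp⟩ := not_forall.1 hJ
    obtain ⟨hp1, hp2⟩ := not_or.1 hp
    have e1 := h1 p
    have e2 := h2 p
    have e3 := h3 p
    simp only [Finset.mem_insert, hp1, hp2, or_false] at e1 e2 e3
    have hcase : b = σ a ∨ c = σ a ∨ c = σ b := by
      have hpp : σ (σ p) = p := hσ p
      grind
    rcases hcase with rfl | rfl | rfl
    · exact hasEdge_of_insert hσ ha hb (hfix a) h1 h4 h5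
    · exact hasEdge_of_insert hσ ha hc (hfix a) h2 h4 h6
    · exact hasEdge_of_insert hσ hb hc (hfix b) h3 h5 h6
  · rintro ⟨X, hX, a', ha'⟩
    -- Replacing `a'` by its partner if necessary, the flip removes `a` and adds `σ a`.
    obtain ⟨a, haX, haO⟩ : ∃ a, a ∈ X ∧ X ∆ {a, σ a} ∈ O := by
      rcases (hO X hX).meetsPairs a' with h | h
      · exact ⟨a', h, ha'⟩
      · exact ⟨σ a', h, by rwa [hσ a', Finset.pair_comm]⟩
    have hXt := hO X hX
    have hσa : σ a ∉ X := (hXt a).1 haX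
    obtain ⟨c', hc'⟩ : ∃ c', c' ∉ ({a, σ a} : Finset V) := by
      by_contra! h
      have : Fintype.card V ≤ ({a, σ a} : Finset V).card :=
        Finset.card_le_card fun x _ => h x
      exact absurd (this.trans Finset.card_le_two) (by omega)
    obtain ⟨c, hcX, hca, hcb, hσcX⟩ : ∃ c, c ∉ X ∧ c ≠ a ∧ c ≠ σ a ∧ σ c ∈ X := by
      simp only [Finset.mem_insert, Finset.mem_singleton, not_or] at hc'
      by_cases h : c' ∈ X
      · refine ⟨σ c', (hXt c').1 h, fun h' => hc'.2 ?_, fun h' => hc'.1 (hσ.injective h'), ?_⟩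
        · exact hσ.eq_iff.1 h'
        · rwa [hσ c']
      · exact ⟨c', h, hc'.1, hc'.2, ((hXt.meetsPairs c').resolve_left h)⟩
    have hXeq : insert a (X.erase a) = X := Finset.insert_erase haX
    have hYeq : insert (σ a) (X.erase a) = X ∆ {a, σ a} := by
      ext v
      simp only [Finset.mem_symmDiff, Finset.mem_insert, Finset.mem_singleton, Finset.mem_erase]
      have := hfix a
      grind
    have hsc : σ c ∈ X.erase a :=
      Finset.mem_erase.2 ⟨fun h => hcb (hσ.eq_iff.1 h), hσcX⟩
    have hYt := hO _ haO
    rw [← hYeq] at haO hYt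
    have mono : ∀ {Y : Finset V} (v : V), MeetsPairs σ Y → MeetsPairs σ (insert v Y) :=
      fun v h w => (h w).imp (Finset.mem_insert_of_mem) (Finset.mem_insert_of_mem)
    -- A set containing a whole pair is not a transversal.
    have hoff : ∀ {Y : Finset V} (v : V), v ∈ Y → σ v ∈ Y → Y ∉ O :=
      fun v h h' hY => (hO _ hY v).1 h h'
    refine ⟨X.erase a, a, σ a, c, ⟨by simp, by simp [hσa], by simp [hcX]⟩,
      ⟨(hfix a).symm, hca.symm, hcb.symm⟩, ⟨⟨?_, ?_⟩, ⟨?_, ?_⟩, ⟨?_, ?_⟩⟩, ?_, ?_, ?_⟩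
    · exact mono _ hYt.meetsPairs
    · exact hoff a (by simp) (by simp)
    · rw [Finset.insert_comm, hXeq]
      exact mono _ hXt.meetsPairs
    · exact hoff c (by simp) (by simp only [Finset.mem_insert, hsc, or_true])
    · rw [Finset.insert_comm]
      exact mono _ hYt.meetsPairs
    · exact hoff c (by simp) (by simp only [Finset.mem_insert, hsc, or_true])
    · rw [hXeq]
      exact fun h => h.2 hX
    · exact fun h => h.2 haO
    · rintro ⟨h, -⟩
      have := h a
      simp [hca.symm, hcb.symm, hσa] at this

/-! ### The number of independent families is odd -/

open Classical in
/-- Flipping all transversals in `O` along one fixed pair is an involution on independent families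
whose only fixed point is `∅`. -/
lemma odd_card_independent [Fintype V] (hσ : Function.Involutive σ) [Nonempty V] :
    Odd (((Finset.univ.filter (IsTransversal σ)).powerset.filter
      (fun O => ¬ HasEdge σ O)).card) := by
  obtain ⟨a⟩ := ‹Nonempty V›
  set S := (Finset.univ.filter (IsTransversal σ)).powerset.filter (fun O => ¬ HasEdge σ O) with hS
  have hempty : (∅ : Finset (Finset V)) ∈ S := by simp [hS, HasEdge]
  have hmem : ∀ O, O ∈ S ↔ (∀ X ∈ O, IsTransversal σ X) ∧ ¬ HasEdge σ O := by
    intro O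
    simp [hS, Finset.subset_iff]
  have hflip : ∀ O : Finset (Finset V),
      (O.image (· ∆ {a, σ a})).image (· ∆ {a, σ a}) = O := by
    intro O
    simp [Finset.image_image, Function.comp_def]
  have hzero : ∑ O ∈ S.erase ∅, (1 : ZMod 2) = 0 := by
    refine Finset.sum_involution (fun O _ => O.image (· ∆ {a, σ a})) ?_ ?_ ?_ ?_
    · intro O _
      decide
    · intro O hO _ hfixed
      obtain ⟨hne, hOS⟩ := Finset.mem_erase.1 hO
      obtain ⟨X, hX⟩ := Finset.nonempty_iff_ne_empty.2 hne
      refine ((hmem O).1 hOS).2 ⟨X, hX, a, ?_⟩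
      rw [← hfixed]
      exact Finset.mem_image_of_mem _ hX
    · intro O hO
      obtain ⟨hne, hOS⟩ := Finset.mem_erase.1 hO
      obtain ⟨ht, hi⟩ := (hmem O).1 hOS
      refine Finset.mem_erase.2 ⟨by simpa using hne, (hmem _).2 ⟨?_, ?_⟩⟩
      · intro Y hY
        obtain ⟨X, hX, rfl⟩ := Finset.mem_image.1 hY
        exact (ht X hX).symmDiff_pair hσ a
      · rintro ⟨Y, hY, b, hb⟩
        obtain ⟨X, hX, rfl⟩ := Finset.mem_image.1 hY
        obtain ⟨Z, hZ, hZX⟩ := Finset.mem_image.1 hb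
        refine hi ⟨X, hX, b, ?_⟩
        rw [symmDiff_right_comm] at hZX
        rwa [← symmDiff_left_injective _ hZX]
    · intro O _
      exact hflip O
  rw [Finset.sum_const, nsmul_eq_mul, mul_one, ZMod.natCast_eq_zero_iff] at hzero
  have hc : S.card = (S.erase ∅).card + 1 := (Finset.card_erase_add_one hempty).symm
  rw [hc]
  exact (even_iff_two_dvd.2 hzero).add_one

end Transversal

/-! ### Decision trees that leave a vertex undetermined -/

/-- Let the answer of the oracle `f O` to a query `X` depend only on whether `X ∈ O`.  If on every
input `O ∪ A` with `O ⊆ U` fewer than `|U|` queries are made, then each output occurs for an even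
number of inputs; in other words, the sum of `φ` over all outputs is even for every `φ`. -/
lemma FilterAlgorithm.even_sum_powerset {V : Type*} [DecidableEq V]
    (f : Finset (Finset V) → Finset V → Bool)
    (hf : ∀ O O' X, (X ∈ O ↔ X ∈ O') → f O X = f O' X) (φ : Bool → ℕ)
    (D : FilterAlgorithm V) :
    ∀ (U A : Finset (Finset V)), Disjoint U A →
      (∀ O ⊆ U, D.calls (f (O ∪ A)) < U.card) →
      Even (∑ O ∈ U.powerset, φ (D.result (f (O ∪ A)))) := by
  induction D with
  | output c =>
    intro U A _ h
    have hU : U.card ≠ 0 := by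
      have := h ∅ (by simp)
      omega
    simp only [result]
    rw [Finset.sum_const, Finset.card_powerset, smul_eq_mul]
    exact (Nat.even_pow.2 ⟨even_two, hU⟩).mul_right _
  | query X next ih =>
    intro U A hUA h
    simp only [calls, result] at h ⊢
    by_cases hX : X ∈ U
    · -- The two answers split the inputs according to whether `X ∈ O`.
      have hXA : X ∉ A := Finset.disjoint_left.1 hUA hX
      obtain ⟨U', hXU', rfl⟩ : ∃ U', X ∉ U' ∧ insert X U' = U :=
        ⟨U.erase X, Finset.notMem_erase _ _, Finset.insert_erase hX⟩
      rw [Finset.card_insert_of_notMem hXU'] at h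
      have hU'A : Disjoint U' A := hUA.mono_left (Finset.subset_insert _ _)
      have hins : ∀ O, insert X O ∪ A = O ∪ insert X A := by
        intro O
        rw [Finset.insert_union, Finset.union_insert]
      have hout : ∀ O ⊆ U', f (O ∪ A) X = f ∅ X := by
        intro O hO
        refine hf _ _ _ ?_
        simp only [Finset.mem_union, hXA, Finset.notMem_empty, iff_false, or_false]
        exact fun h => hXU' (hO h)
      have hin : ∀ O, f (O ∪ insert X A) X = f {X} X := by
        intro O
        exact hf _ _ _ (by simp)
      rw [Finset.sum_powerset_insert hXU']
      refine Even.add ?_ ?_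
      · have := ih (f ∅ X) U' A hU'A fun O hO => by
          have := h O (hO.trans (Finset.subset_insert _ _))
          rw [hout O hO] at this
          omega
        refine (congrArg Even ?_).mpr this
        refine Finset.sum_congr rfl fun O hO => ?_
        rw [hout O (Finset.mem_powerset.1 hO)]
      · have := ih (f {X} X) U' (insert X A)
          (Finset.disjoint_insert_right.2 ⟨hXU', hU'A⟩) fun O hO => by
          have := h (insert X O) (Finset.insert_subset_insert _ hO)
          rw [hins, hin O] at this
          omega
        refine (congrArg Even ?_).mpr this
        refine Finset.sum_congr rfl fun O _ => ?_
        rw [hins, hin O]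
    · -- The answer is the same on all inputs.
      have hconst : ∀ O ⊆ U, f (O ∪ A) X = f A X := by
        intro O hO
        refine hf _ _ _ ?_
        simp only [Finset.mem_union, or_iff_right_iff_imp]
        exact fun h => absurd (hO h) hX
      have := ih (f A X) U A hUA fun O hO => by
        have := h O hO
        rw [hconst O hO] at this
        omega
      refine (congrArg Even ?_).mpr this
      refine Finset.sum_congr rfl fun O hO => ?_
      rw [hconst O (Finset.mem_powerset.1 hO)]

/-! ### The lower bound -/

/-- A set of `2 n` elements has a pairing, and a pairing into `n` pairs has (at least) `2 ^ n`
transversals. -/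
lemma exists_pairing {V : Type*} [Fintype V] {n : ℕ} (hV : Fintype.card V = 2 * n) :
    ∃ σ : V → V, Function.Involutive σ ∧ (∀ v, σ v ≠ v) ∧
      ∃ x : (Fin n → Bool) → Finset V, Function.Injective x ∧ ∀ p, IsTransversal σ (x p) := by
  have e : V ≃ Fin n × Bool :=
    Fintype.equivOfCardEq (by simp [hV, mul_comm])
  refine ⟨fun v => e.symm ((e v).1, !(e v).2), fun v => by simp, fun v h => ?_,
    fun p => Finset.univ.filter fun v => p (e v).1 = (e v).2, fun p q h => ?_, fun p v => ?_⟩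
  · have := congrArg (fun w => (e w).2) h
    simp at this
  · replace h : (Finset.univ.filter fun v => p (e v).1 = (e v).2) =
        Finset.univ.filter fun v => q (e v).1 = (e v).2 := h
    funext i
    have : e.symm (i, p i) ∈ Finset.univ.filter fun v => q (e v).1 = (e v).2 := by
      rw [← h]
      simp
    simpa using (Finset.mem_filter.1 this).2.symm
  · simp

theorem theorem2 (n : ℕ) (hn : 2 ≤ n) {V : Type*} [Fintype V] (hV : Fintype.card V = 2 * n)
    (D : FilterAlgorithm V) (hD : D.DecidesDelta3Minor) :
    ∃ C : Clutter V, 2 ^ n ≤ D.calls C.filterOracle := by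
  classical
  obtain ⟨σ, hσ, hfix, x, hx, hxt⟩ := exists_pairing hV
  by_contra! hlt
  set T : Finset (Finset V) := Finset.univ.filter (IsTransversal σ) with hT
  have hTcard : 2 ^ n ≤ T.card := by
    have : (Finset.univ.image x).card = 2 ^ n := by
      rw [Finset.card_image_of_injective _ hx]
      simp
    rw [← this]
    refine Finset.card_le_card fun X hX => ?_
    obtain ⟨p, -, rfl⟩ := Finset.mem_image.1 hX
    simpa [hT] using hxt p
  have hTt : ∀ O ⊆ T, ∀ X ∈ O, IsTransversal σ X := fun O hO X hX => by
    simpa [hT] using hO hX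
  have horacle : ∀ O ⊆ T, (offClutter σ O).filterOracle =
      fun X => decide (MeetsPairs σ X ∧ X ∉ O) := by
    intro O hO
    funext X
    rw [Bool.eq_iff_iff, filterOracle_offClutter (hTt O hO), decide_eq_true_iff]
  have heven := FilterAlgorithm.even_sum_powerset
    (fun O X => decide (MeetsPairs σ X ∧ X ∉ O))
    (fun O O' X h => by simp [h]) (fun r => if r then 0 else 1) D T ∅ (by simp) (fun O hO => by
      rw [Finset.union_empty, ← horacle O hO]
      exact (hlt _).trans_le hTcard)
  have : Nonempty V := Fintype.card_pos_iff.1 (by omega)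
  refine Nat.not_even_iff_odd.2 (odd_card_independent hσ) ?_
  rw [Finset.card_filter]
  refine (congrArg Even ?_).mpr heven
  refine Finset.sum_congr rfl fun O hO => ?_
  have hO' := Finset.mem_powerset.1 hO
  have h1 := hD (offClutter σ O)
  rw [offClutter_hasDelta3Minor_iff hσ hfix (by omega) (hTt O hO'), horacle O hO'] at h1
  simp only [Finset.union_empty, ← h1, ite_not]
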